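/- Group testing: among $N$ items, an unknown set $\mathcal K$ of $K$ items, uniformly distributed over the subsets of size $K$, is defective. In a Bernoulli$(p)$ test design with $T$ tests, each item is included in each test with probability $p$, independently over items and tests (and of $\mathcal K$); a test is positive if it contains at least one defective item, and negative otherwise. The DD (definite defectives) algorithm calls an item a possible defective if it is in no negative test, and estimates $\mathcal K$ by the set $\widehat{\mathcal K}$ of those possible defectives that are the only possible defective in some positive test. Its error probability is $\mathbb P(\widehat{\mathcal K}\neq\mathcal K)$, and its rate is $\log_2\binom NK/T$. A rate $R\in\mathbb R$ is achievable by DD with a Bernoulli$(1/K)$ test design in sparsity regime $\beta$ if for every $\delta>0$ and all sufficiently large $N$, with $K=N^{1-\beta}$ (rounded up or down to an integer; both choices are required to work), there is a number $T\ge 1$ of tests such that $\log_2\binom NK/T\ge R$ and the error probability is at most $\delta$. Let $R^*_{\mathrm{DD}}(\beta)$ be the maximum achievable rate, i.e. the supremum of the achievable rates. Theorem. For every $0<\beta<1$, $$R^*_{\mathrm{DD}}(\beta)\ \ge\ \frac{1}{e\ln 2}\,\min\left\{1,\frac{\beta}{1-\beta}\right\}.$$ -/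

import Mathlib

open scoped BigOperators

noncomputable section

namespace GroupTesting

/-- A testing matrix for `N` items and `T` tests: `X i t = true` when item `i` is in test `t`. -/
abbrev TestMatrix (N T : ℕ) : Type := Fin N → Fin T → Bool

/-- The outcomes of the tests when the defective set is `D`: a test is positive when it contains
at least one defective item. -/
def outcome {N T : ℕ} (X : TestMatrix N T) (D : Finset (Fin N)) : Fin T → Bool :=
  fun t => decide (∃ i ∈ D, X i t = true)

/-- A detection algorithm (for all numbers of items and tests): it turns the testing matrix and
the vector of outcomes into an estimate of the defective set. -/
abbrev DetectionAlgorithm : Type :=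
  ∀ N T : ℕ, TestMatrix N T → (Fin T → Bool) → Finset (Fin N)

/-- The guaranteed not defective items: those which appear in some negative test. -/
def notDefectives {N T : ℕ} (X : TestMatrix N T) (y : Fin T → Bool) : Finset (Fin N) :=
  Finset.univ.filter fun i => ∃ t, X i t = true ∧ y t = false

/-- The possible defectives: all other items. -/
def possibleDefectives {N T : ℕ} (X : TestMatrix N T) (y : Fin T → Bool) : Finset (Fin N) :=
  (notDefectives X y)ᶜ

/-- The definite defectives: the possible defectives which are the only possible defective in
some positive test. -/
def definiteDefectives {N T : ℕ} (X : TestMatrix N T) (y : Fin T → Bool) : Finset (Fin N) :=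
  (possibleDefectives X y).filter fun i =>
    ∃ t, X i t = true ∧ (∀ j ∈ possibleDefectives X y \ {i}, X j t = false) ∧ y t = true

/-- The DD algorithm declares defective exactly the definite defectives. -/
def DD : DetectionAlgorithm := fun _ _ X y => definiteDefectives X y

/-- The probability of the matrix `X` under the Bernoulli(`p`) test design: all entries are
independent, each of them `true` with probability `p`. -/
def bernoulliWeight {N T : ℕ} (p : ℝ) (X : TestMatrix N T) : ℝ :=
  ∏ i, ∏ t, if X i t = true then p else 1 - p

open Classical in
/-- The probability of an event under the Bernoulli(`p`) test design. -/
def bernoulliProb {N T : ℕ} (p : ℝ) (E : Set (TestMatrix N T)) : ℝ :=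
  ∑ X ∈ Finset.univ.filter (fun X => X ∈ E), bernoulliWeight p X

/-- The average error probability of the algorithm `A` with `N` items, `K` defectives and `T` tests
from the Bernoulli(`p`) design; the defective set is uniform among the sets of size `K`. -/
def avgError (A : DetectionAlgorithm) (p : ℝ) (N K T : ℕ) : ℝ :=
  (1 / (N.choose K : ℝ)) *
    ∑ D ∈ Finset.powersetCard K (Finset.univ : Finset (Fin N)),
      bernoulliProb p {X : TestMatrix N T | A N T X (outcome X D) ≠ D}

/-- The rate of an algorithm that uses `T` tests for `K` defectives among `N` items. -/
def rate (N K T : ℕ) : ℝ := Real.logb 2 (N.choose K : ℝ) / (T : ℝ)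

/-- `K = N ^ (1 - β)` up to rounding (up or down) to an integer; if `N ^ (1 - β)` is an integer,
then `K` is equal to it. -/
def InRegime (β : ℝ) (N K : ℕ) : Prop := |(K : ℝ) - (N : ℝ) ^ (1 - β)| < 1

/-- The rate `R` is achievable by the algorithm `A` with Bernoulli(`p K`) test designs in sparsity
regime `β`: for every `δ > 0` and all large `N`, whichever way `K = N ^ (1 - β)` is rounded, some
number `T ≥ 1` of tests gives rate at least `R` and error probability at most `δ`. -/
def IsAchievable (A : DetectionAlgorithm) (p : ℕ → ℝ) (β R : ℝ) : Prop :=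
  ∀ δ : ℝ, 0 < δ → ∃ N₀ : ℕ, ∀ N : ℕ, N₀ ≤ N → ∀ K : ℕ, InRegime β N K →
    ∃ T : ℕ, 1 ≤ T ∧ R ≤ rate N K T ∧ avgError A (p K) N K T ≤ δ

/-- The maximum achievable rate, as a supremum in the extended reals. -/
def maxRate (A : DetectionAlgorithm) (p : ℕ → ℝ) (β : ℝ) : EReal :=
  sSup ((fun R : ℝ => (R : EReal)) '' {R : ℝ | IsAchievable A p β R})

end GroupTesting

end

/-! ### Expectation and independence in the Bernoulli design -/

namespace GroupTesting

open Finset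

/-! DD never accuses a nondefective item, so it errs only by missing a defective `i`. Then every
test in which `i` is the sole defective contains an intruder, a nondefective item that no negative
test rules out (`exists_intruder_of_notMem`). Fix a threshold `g`. Markov's inequality bounds the
probability of more than `g` intruders (`expect_intruders_gt_le`). The set of intruders is
determined by the defective rows and the negative tests, so the entries of the intruders in positive
tests are still fresh. With at most `g` intruders, a test with `i` as sole defective is therefore
clean with conditional probability at least `(1-p)^g`, which bounds the probability of a miss
(`expect_miss_le`).

With `p = 1/K`, `g ≈ cK` and `T ≈ e m K log N`, for small `c`, the two terms are of order `N^(β-m)`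
and `N^(1-β-m)`; both vanish when `m > max β (1-β)`. Since `log (N.choose K)` is about `β K log N`
or more, the rate approaches `β / (e ln 2 · max β (1-β))`. -/

/-- The expectation of a function of the testing matrix under the Bernoulli(`p`) design. -/
noncomputable def expect {N T : ℕ} (p : ℝ) (f : TestMatrix N T → ℝ) : ℝ :=
  ∑ X, bernoulliWeight p X * f X

/-- The expectation of a function of a single column of Bernoulli(`p`) entries. -/
noncomputable def columnExpect {N : ℕ} (p : ℝ) (f : (Fin N → Bool) → ℝ) : ℝ :=
  ∑ z : Fin N → Bool, (∏ i, if z i = true then p else 1 - p) * f z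

lemma one_sub_ite (Q : Prop) [Decidable Q] :
    (1 - if Q then (1 : ℝ) else 0) = if ¬ Q then 1 else 0 := by
  split_ifs <;> simp

section Expectation

variable {N T : ℕ} {p : ℝ}

lemma bernoulliWeight_nonneg (h0 : 0 ≤ p) (h1 : p ≤ 1) (X : TestMatrix N T) :
    0 ≤ bernoulliWeight p X := by
  refine prod_nonneg fun i _ => prod_nonneg fun t _ => ?_
  split_ifs <;> linarith

lemma expect_mono (h0 : 0 ≤ p) (h1 : p ≤ 1) {f g : TestMatrix N T → ℝ} (h : ∀ X, f X ≤ g X) :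
    expect p f ≤ expect p g :=
  sum_le_sum fun X _ => mul_le_mul_of_nonneg_left (h X) (bernoulliWeight_nonneg h0 h1 X)

lemma expect_add (f g : TestMatrix N T → ℝ) :
    expect p (fun X => f X + g X) = expect p f + expect p g := by
  simp only [expect, mul_add, sum_add_distrib]

lemma expect_sum {ι : Type*} (s : Finset ι) (f : ι → TestMatrix N T → ℝ) :
    expect p (fun X => ∑ i ∈ s, f i X) = ∑ i ∈ s, expect p (f i) := by
  simp only [expect, mul_sum]
  exact sum_comm

lemma expect_mul_const (f : TestMatrix N T → ℝ) (c : ℝ) :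
    expect p (fun X => f X * c) = expect p f * c := by
  simp only [expect, sum_mul, mul_assoc]

open Classical in
lemma bernoulliProb_eq_expect (E : Set (TestMatrix N T)) :
    bernoulliProb p E = expect p (fun X => if X ∈ E then 1 else 0) := by
  simp [bernoulliProb, expect, sum_filter]

/-- Different tests are independent. -/
lemma expect_of_eq_prod {F : TestMatrix N T → ℝ} (f : Fin T → (Fin N → Bool) → ℝ)
    (hF : ∀ X, F X = ∏ t, f t (fun i => X i t)) : expect p F = ∏ t, columnExpect p (f t) := by
  simp only [columnExpect, prod_univ_sum, Fintype.piFinset_univ, expect]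
  refine Fintype.sum_equiv (Equiv.piComm fun _ _ => Bool) _ _ fun X => ?_
  rw [bernoulliWeight, prod_comm, hF, ← prod_mul_distrib]
  rfl

lemma columnExpect_of_eq_prod {f : (Fin N → Bool) → ℝ} (h : Fin N → Bool → ℝ)
    (hf : ∀ z, f z = ∏ i, h i (z i)) :
    columnExpect p f = ∏ i, (p * h i true + (1 - p) * h i false) := by
  have : ∀ i, p * h i true + (1 - p) * h i false
      = ∑ b : Bool, (if b = true then p else 1 - p) * h i b := fun i => by simp
  simp only [this, prod_univ_sum, Fintype.piFinset_univ, columnExpect, prod_mul_distrib, hf]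

lemma columnExpect_one : columnExpect p (fun _ : Fin N → Bool => 1) = 1 := by
  simpa using columnExpect_of_eq_prod (N := N) (p := p) (f := fun _ => 1) (fun _ _ => 1) (by simp)

lemma expect_one : expect p (fun _ : TestMatrix N T => 1) = 1 := by
  simpa [columnExpect_one] using
    expect_of_eq_prod (N := N) (T := T) (p := p) (F := fun _ => 1) (fun _ _ => 1) (by simp)

lemma columnExpect_one_sub_mul (c : ℝ) (f : (Fin N → Bool) → ℝ) :
    columnExpect p (fun z => 1 - c * f z) = 1 - c * columnExpect p f := by
  conv_rhs => rw [← columnExpect_one (N := N) (p := p)]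
  simp only [columnExpect, mul_sum, ← sum_sub_distrib]
  exact sum_congr rfl fun z _ => by ring

lemma columnExpect_all_false (S : Finset (Fin N)) :
    columnExpect p (fun z => if ∀ k ∈ S, z k = false then 1 else 0) = (1 - p) ^ #S := by
  refine (columnExpect_of_eq_prod (fun k b => if k ∈ S → b = false then 1 else 0)
    fun z => by simp [prod_ite_zero]).trans ?_
  rw [← prod_const, ← prod_subset (subset_univ S)]
  · exact prod_congr rfl fun k hk => by simp [hk]
  · intro k _ hk
    simp [hk]

lemma columnExpect_true_and_all_false {i : Fin N} {S : Finset (Fin N)} (hi : i ∉ S) :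
    columnExpect p (fun z => if z i = true ∧ ∀ k ∈ S, z k = false then 1 else 0)
      = p * (1 - p) ^ #S := by
  refine (columnExpect_of_eq_prod
    (fun k b => if (k = i → b = true) ∧ (k ∈ S → b = false) then 1 else 0)
    fun z => by simp [prod_ite_zero, forall_and]).trans ?_
  rw [← prod_subset (subset_univ (insert i S)), prod_insert hi]
  · congr 1
    · simp [hi]
    · rw [← prod_const]
      refine prod_congr rfl fun k hk => ?_
      have : k ≠ i := fun h => hi (h ▸ hk)
      simp [hk, this]
  · intro k _ hk
    rw [mem_insert, not_or] at hk
    simp [hk.1, hk.2]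

/-- Functions of disjoint sets of entries are independent. -/
lemma expect_mul_of_disjoint (U : Fin N → Fin T → Prop) (f h : TestMatrix N T → ℝ)
    (hf : ∀ X Y : TestMatrix N T, (∀ i t, U i t → X i t = Y i t) → f X = f Y)
    (hh : ∀ X Y : TestMatrix N T, (∀ i t, ¬ U i t → X i t = Y i t) → h X = h Y) :
    expect p (fun X => f X * h X) = expect p f * expect p h := by
  classical
  -- Take two independent copies of the matrix and exchange their entries outside `U`. This
  -- involution preserves the product weight and turns `f X * h Y` into `f X * h X`.
  let mix : TestMatrix N T → TestMatrix N T → TestMatrix N T :=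
    fun X Y i t => if U i t then X i t else Y i t
  let σ : TestMatrix N T × TestMatrix N T → TestMatrix N T × TestMatrix N T :=
    fun q => (mix q.1 q.2, mix q.2 q.1)
  have hσ : Function.Involutive σ := fun q => by
    refine Prod.ext ?_ ?_ <;> funext i t <;> by_cases hu : U i t <;> simp [σ, mix, hu]
  have hw : ∀ X Y, bernoulliWeight p (mix X Y) * bernoulliWeight p (mix Y X)
      = bernoulliWeight p X * bernoulliWeight p Y := fun X Y => by
    simp only [bernoulliWeight, ← prod_mul_distrib]
    refine prod_congr rfl fun i _ => prod_congr rfl fun t _ => ?_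
    by_cases hu : U i t
    · simp [mix, hu]
    · simp only [mix, hu, if_false]
      rw [mul_comm]
  have hfm : ∀ X Y, f (mix X Y) = f X := fun X Y =>
    hf _ _ fun i t hu => by simp [mix, hu]
  have hhm : ∀ X Y, h (mix Y X) = h X := fun X Y =>
    hh _ _ fun i t hu => by simp [mix, hu]
  have key : expect p f * expect p h
      = expect p (fun X => f X * h X) * expect p (fun _ : TestMatrix N T => 1) := by
    simp only [expect, sum_mul_sum, ← Fintype.sum_prod_type']
    rw [← Equiv.sum_comp hσ.toPerm]
    refine sum_congr rfl fun q _ => ?_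
    simp only [Function.Involutive.coe_toPerm, σ, hfm, hhm]
    linear_combination f q.1 * h q.1 * hw q.1 q.2
  rw [key, expect_one, mul_one]

end Expectation

/-! ### Finite-length analysis of DD -/

section DefiniteDefectives

variable {N T : ℕ} {p : ℝ}

/-- The nondefective items which no negative test rules out. -/
def intruders (D : Finset (Fin N)) (X : TestMatrix N T) : Finset (Fin N) :=
  possibleDefectives X (outcome X D) \ D

/-- In the column `z`, the item `i` is the only element of `D`. -/
abbrev IsSole (D : Finset (Fin N)) (i : Fin N) (z : Fin N → Bool) : Prop :=
  z i = true ∧ ∀ k ∈ D.erase i, z k = false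

lemma outcome_eq_false {X : TestMatrix N T} {D : Finset (Fin N)} {t : Fin T} :
    outcome X D t = false ↔ ∀ d ∈ D, X d t = false := by
  simp [outcome]

lemma outcome_eq_true {X : TestMatrix N T} {D : Finset (Fin N)} {t : Fin T} :
    outcome X D t = true ↔ ∃ d ∈ D, X d t = true := by
  simp [outcome]

lemma mem_possibleDefectives {X : TestMatrix N T} {y : Fin T → Bool} {i : Fin N} :
    i ∈ possibleDefectives X y ↔ ∀ t, y t = false → X i t = false := by
  simp only [possibleDefectives, notDefectives, mem_compl, mem_filter, mem_univ, true_and,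
    not_exists, not_and]
  refine forall_congr' fun t => ?_
  cases X i t <;> cases y t <;> simp

lemma subset_possibleDefectives (X : TestMatrix N T) (D : Finset (Fin N)) :
    D ⊆ possibleDefectives X (outcome X D) := fun i hi => by
  rw [mem_possibleDefectives]
  exact fun t ht => outcome_eq_false.1 ht i hi

/-- A positive test contains a defective, which is itself a possible defective; a sole possible
defective must be that item. -/
lemma definiteDefectives_subset (X : TestMatrix N T) (D : Finset (Fin N)) :
    definiteDefectives X (outcome X D) ⊆ D := fun i hi => by
  simp only [definiteDefectives, mem_filter] at hi
  obtain ⟨-, t, -, hj, hy⟩ := hi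
  obtain ⟨d, hd, hdt⟩ := outcome_eq_true.1 hy
  by_contra hiD
  have := hj d (mem_sdiff.2 ⟨subset_possibleDefectives X D hd, by
    rw [mem_singleton]; rintro rfl; exact hiD hd⟩)
  simp [hdt] at this

lemma exists_intruder_of_notMem {X : TestMatrix N T} {D : Finset (Fin N)} {i : Fin N} (hi : i ∈ D)
    (h : i ∉ definiteDefectives X (outcome X D)) {t : Fin T}
    (ht : IsSole D i fun k => X k t) : ∃ j ∈ intruders D X, X j t = true := by
  by_contra! hc
  refine h (mem_filter.2 ⟨subset_possibleDefectives X D hi, t, ht.1, fun j hj => ?_,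
    outcome_eq_true.2 ⟨i, hi, ht.1⟩⟩)
  rw [mem_sdiff, mem_singleton] at hj
  by_cases hjD : j ∈ D
  · exact ht.2 j (mem_erase.2 ⟨hj.2, hjD⟩)
  · simpa using hc j (mem_sdiff.2 ⟨hj.1, hjD⟩)

/-- `j` survives iff no test contains `j` and avoids `D`; the tests are independent. -/
lemma expect_mem_intruders {D : Finset (Fin N)} {j : Fin N} (hj : j ∉ D) :
    expect p (fun X : TestMatrix N T => if j ∈ intruders D X then 1 else 0)
      = (1 - p * (1 - p) ^ #D) ^ T := by
  refine (expect_of_eq_prod (fun _ z => 1 - 1 * if z j = true ∧ ∀ k ∈ D, z k = false then 1 else 0)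
    fun X => ?_).trans ?_
  · simp only [one_mul, one_sub_ite, prod_ite_zero, prod_const_one]
    refine if_congr ?_ rfl rfl
    simp only [intruders, mem_sdiff, hj, mem_possibleDefectives, outcome_eq_false,
      not_false_eq_true, and_true, mem_univ, true_implies]
    refine forall_congr' fun t => ?_
    rw [← Bool.not_eq_true, not_and']
  rw [prod_const, card_univ, Fintype.card_fin, columnExpect_one_sub_mul,
    columnExpect_true_and_all_false hj, one_mul]

/-- Markov's inequality for the number of intruders. -/
lemma expect_intruders_gt_le (h0 : 0 ≤ p) (h1 : p ≤ 1) (D : Finset (Fin N)) (g : ℕ) :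
    expect p (fun X : TestMatrix N T => if g < #(intruders D X) then 1 else 0)
      ≤ N * (1 - p * (1 - p) ^ #D) ^ T / (g + 1) := by
  have hg : (0 : ℝ) < g + 1 := by positivity
  have hq : p * (1 - p) ^ #D ≤ 1 :=
    mul_le_one₀ h1 (pow_nonneg (by linarith) _) (pow_le_one₀ (by linarith) (by linarith))
  calc _ ≤ expect p (fun X : TestMatrix N T =>
        (∑ j ∈ Dᶜ, if j ∈ intruders D X then (1 : ℝ) else 0) * (1 / (g + 1))) := by
        refine expect_mono h0 h1 fun X => ?_
        have hc : (∑ j ∈ Dᶜ, if j ∈ intruders D X then (1 : ℝ) else 0) = #(intruders D X) := by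
          rw [sum_boole, filter_mem_eq_inter, inter_eq_right.2]
          intro k hk
          exact mem_compl.2 (mem_sdiff.1 hk).2
        rw [hc, mul_one_div]
        split_ifs with h
        · rw [one_le_div hg]
          exact_mod_cast h
        · positivity
    _ = #Dᶜ * (1 - p * (1 - p) ^ #D) ^ T / (g + 1) := by
        rw [expect_mul_const, expect_sum, sum_congr rfl
          (fun j hj => expect_mem_intruders (mem_compl.1 hj)), sum_const, nsmul_eq_mul,
          mul_one_div]
    _ ≤ _ := by
        have : #Dᶜ ≤ N := by simpa using card_le_univ Dᶜ
        gcongr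

/-- The probability that in each of the tests `t` with `P t` some item of `S` is present. -/
lemma expect_all_hit (S : Finset (Fin N)) (P : Fin T → Prop) [DecidablePred P] :
    expect p (fun X : TestMatrix N T => if ∀ t, P t → ∃ j ∈ S, X j t = true then 1 else 0)
      = ∏ t, if P t then 1 - (1 - p) ^ #S else 1 := by
  refine (expect_of_eq_prod (fun t z => 1 - (if P t then 1 else 0) *
    if ∀ k ∈ S, z k = false then 1 else 0) fun X => ?_).trans (prod_congr rfl fun t _ => ?_)
  · simp only [ite_zero_mul_ite_zero, mul_one, one_sub_ite, prod_ite_zero, prod_const_one]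
    refine if_congr ?_ rfl rfl
    simp
  rw [columnExpect_one_sub_mul, columnExpect_all_false]
  split_ifs <;> simp

/-- Generating function of the binomial number of tests in which `i` is the sole defective. -/
lemma expect_prod_sole {D : Finset (Fin N)} {i : Fin N} (c : ℝ) :
    expect p (fun X : TestMatrix N T => ∏ t, if IsSole D i (fun k => X k t) then 1 - c else 1)
      = (1 - c * (p * (1 - p) ^ #(D.erase i))) ^ T := by
  refine (expect_of_eq_prod
    (fun _ z => 1 - c * if z i = true ∧ ∀ k ∈ D.erase i, z k = false then 1 else 0)
    fun X => prod_congr rfl fun t _ => ?_).trans ?_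
  · rw [mul_ite, mul_one, mul_zero, sub_ite, sub_zero]
  rw [prod_const, card_univ, Fintype.card_fin, columnExpect_one_sub_mul,
    columnExpect_true_and_all_false (notMem_erase i D)]

/-- The defective rows of a testing matrix. -/
def defectiveRows (D : Finset (Fin N)) (X : TestMatrix N T) : TestMatrix N T :=
  fun k t => if k ∈ D then X k t else false

lemma defectiveRows_apply {D : Finset (Fin N)} {X : TestMatrix N T} {k : Fin N} (hk : k ∈ D)
    (t : Fin T) : defectiveRows D X k t = X k t := if_pos hk

lemma isSole_defectiveRows {D : Finset (Fin N)} {X : TestMatrix N T} {i : Fin N} (hi : i ∈ D)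
    (t : Fin T) : IsSole D i (fun k => defectiveRows D X k t) ↔ IsSole D i (fun k => X k t) := by
  simp only [IsSole, defectiveRows_apply hi]
  refine and_congr_right fun _ => forall₂_congr fun k hk => ?_
  rw [defectiveRows_apply (mem_of_mem_erase hk)]

/-- Given the defective rows and the set of intruders, the entries of the intruders in the positive
tests are independent of the conditioning. -/
lemma expect_conditioned (D : Finset (Fin N)) {i : Fin N} (hi : i ∈ D)
    (a : TestMatrix N T) (S : Finset (Fin N)) (hS : Disjoint S D) :
    expect p (fun X : TestMatrix N T =>
        (if defectiveRows D X = a ∧ intruders D X = S then (1 : ℝ) else 0) *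
          if ∀ t, IsSole D i (fun k => a k t) → ∃ j ∈ S, X j t = true then 1 else 0)
      = expect p (fun X : TestMatrix N T =>
        (if defectiveRows D X = a ∧ intruders D X = S then (1 : ℝ) else 0) *
          ∏ t, if IsSole D i (fun k => a k t) then 1 - (1 - p) ^ #S else 1) := by
  rw [expect_mul_const, ← expect_all_hit]
  -- The entries examined by the conditioning: the defective rows and the columns negative under
  -- `a`. Using `a` rather than `X` keeps this set deterministic.
  refine expect_mul_of_disjoint (fun k t => k ∈ D ∨ ∀ d ∈ D, a d t = false) _ _ ?_ ?_
  · have one_way : ∀ X Y : TestMatrix N T,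
        (∀ k t, (k ∈ D ∨ ∀ d ∈ D, a d t = false) → X k t = Y k t) →
        defectiveRows D X = a ∧ intruders D X = S → defectiveRows D Y = a ∧ intruders D Y = S := by
      rintro X Y hXY ⟨rfl, rfl⟩
      have hD : ∀ t, ∀ d ∈ D, X d t = Y d t := fun t d hd => hXY d t (Or.inl hd)
      have hneg : ∀ t, (∀ d ∈ D, X d t = false) ↔ ∀ d ∈ D, Y d t = false := fun t =>
        forall₂_congr fun d hd => by rw [hD t d hd]
      refine ⟨?_, ?_⟩
      · funext k t
        by_cases hk : k ∈ D
        · simp [defectiveRows, hk, hD t k hk]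
        · simp [defectiveRows, hk]
      · ext k
        simp only [intruders, mem_sdiff, mem_possibleDefectives, outcome_eq_false]
        refine and_congr_left fun _ => forall_congr' fun t => ?_
        rw [hneg t]
        refine imp_congr_right fun hy => ?_
        rw [hXY k t (Or.inr fun d hd => by
          rw [defectiveRows_apply hd]; exact (hneg t).2 hy d hd)]
    intro X Y hXY
    have : (defectiveRows D X = a ∧ intruders D X = S) ↔
        (defectiveRows D Y = a ∧ intruders D Y = S) :=
      ⟨one_way X Y hXY, one_way Y X fun k t h => (hXY k t h).symm⟩
    simp only [this]
  · intro X Y hXY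
    have : (∀ t, IsSole D i (fun k => a k t) → ∃ j ∈ S, X j t = true) ↔
        ∀ t, IsSole D i (fun k => a k t) → ∃ j ∈ S, Y j t = true := by
      refine forall₂_congr fun t ht => exists_congr fun j => and_congr_right fun hj => ?_
      rw [hXY j t]
      rintro (h | h)
      · exact disjoint_left.1 hS hj h
      · simpa [ht.1] using h i hi
    simp only [this]

/-- Condition on the defective rows and the intruders, bound the conditional probability of a miss
by a product that no longer involves the intruders, then undo the conditioning. -/
lemma expect_miss_le (h0 : 0 ≤ p) (h1 : p ≤ 1) {D : Finset (Fin N)} {i : Fin N} (hi : i ∈ D)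
    (g : ℕ) :
    expect p (fun X : TestMatrix N T =>
        if i ∉ definiteDefectives X (outcome X D) ∧ #(intruders D X) ≤ g then 1 else 0)
      ≤ (1 - p * (1 - p) ^ (#D - 1 + g)) ^ T := by
  classical
  have split : ∀ F : TestMatrix N T → ℝ, expect p F
      = ∑ v : TestMatrix N T × Finset (Fin N), expect p (fun X =>
        (if defectiveRows D X = v.1 ∧ intruders D X = v.2 then (1 : ℝ) else 0) * F X) := by
    intro F
    rw [← expect_sum]
    congr 1
    funext X
    rw [← sum_mul, sum_eq_single (defectiveRows D X, intruders D X)]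
    · simp
    · rintro ⟨a, S⟩ - hv
      rw [if_neg]
      rintro ⟨rfl, rfl⟩
      exact hv rfl
    · simp
  have hq0 : 0 ≤ 1 - p := by linarith
  have hq1 : 1 - p ≤ 1 := by linarith
  have hfac : ∀ (n : ℕ) (P : Prop) [Decidable P], 0 ≤ if P then 1 - (1 - p) ^ n else 1 := by
    intro n P _
    have := pow_le_one₀ (n := n) hq0 hq1
    split_ifs <;> linarith
  calc _ ≤ expect p (fun X : TestMatrix N T =>
        ∏ t, if IsSole D i (fun k => X k t) then 1 - (1 - p) ^ g else 1) := by
        rw [split, split (fun X => ∏ t, _)]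
        refine sum_le_sum ?_
        rintro ⟨a, S⟩ -
        by_cases hS : Disjoint S D ∧ #S ≤ g
        · calc _ ≤ _ := expect_mono h0 h1 fun X => ?_
            _ = _ := expect_conditioned (p := p) D hi a S hS.1
            _ ≤ _ := expect_mono h0 h1 fun X => ?_
          · by_cases hX : defectiveRows D X = a ∧ intruders D X = S
            · simp only [hX, and_self, if_true, one_mul]
              by_cases hm : i ∉ definiteDefectives X (outcome X D)
              · have : ∀ t, IsSole D i (fun k => a k t) → ∃ j ∈ S, X j t = true := by
                  intro t ht
                  obtain ⟨rfl, rfl⟩ := hX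
                  exact exists_intruder_of_notMem hi hm ((isSole_defectiveRows hi t).1 ht)
                rw [if_pos this]
                split_ifs <;> norm_num
              · rw [if_neg fun h => hm h.1]
                split_ifs <;> norm_num
            · simp [hX]
          · by_cases hX : defectiveRows D X = a ∧ intruders D X = S
            · simp only [hX, and_self, if_true, one_mul]
              -- Replacing `#S` by `g` removes the dependence on the intruders.
              refine prod_le_prod (fun t _ => hfac _ _) fun t _ => ?_
              have hiff : IsSole D i (fun k => a k t) ↔ IsSole D i (fun k => X k t) := by
                rw [← hX.1]
                exact isSole_defectiveRows hi t
              simp only [hiff]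
              split_ifs
              · linarith [pow_le_pow_of_le_one hq0 hq1 hS.2]
              · exact le_rfl
            · simp [hX]
        -- Intruders are always disjoint from `D`, so here `#S > g` whenever the event occurs, and
        -- the miss indicator is zero.
        · refine expect_mono h0 h1 fun X => ?_
          by_cases hX : defectiveRows D X = a ∧ intruders D X = S
          · have hSd : Disjoint S D := hX.2 ▸ sdiff_disjoint
            have : ¬ #(intruders D X) ≤ g := by
              rw [hX.2]
              exact fun h => hS ⟨hSd, h⟩
            have hF : (if i ∉ definiteDefectives X (outcome X D) ∧ #(intruders D X) ≤ g
                then (1 : ℝ) else 0) = 0 := if_neg fun h => this h.2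
            rw [hF, mul_zero]
            exact mul_nonneg (by split_ifs <;> norm_num) (prod_nonneg fun t _ => hfac _ _)
          · simp [hX]
    _ = _ := by
        rw [expect_prod_sole, card_erase_of_mem hi, pow_add]
        congr 1
        ring

/-- A finite-length bound on the error probability of DD. -/
lemma bernoulliProb_error_le (h0 : 0 ≤ p) (h1 : p ≤ 1) (D : Finset (Fin N)) (g : ℕ) :
    bernoulliProb p {X : TestMatrix N T | DD N T X (outcome X D) ≠ D}
      ≤ N * (1 - p * (1 - p) ^ #D) ^ T / (g + 1)
        + #D * (1 - p * (1 - p) ^ (#D - 1 + g)) ^ T := by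
  classical
  rw [bernoulliProb_eq_expect]
  calc _ ≤ expect p (fun X : TestMatrix N T => (if g < #(intruders D X) then (1 : ℝ) else 0)
        + ∑ i ∈ D, if i ∉ definiteDefectives X (outcome X D) ∧ #(intruders D X) ≤ g
            then 1 else 0) := by
        refine expect_mono h0 h1 fun X => ?_
        have hs : ∀ i ∈ D, (0 : ℝ) ≤ if i ∉ definiteDefectives X (outcome X D) ∧
            #(intruders D X) ≤ g then 1 else 0 := fun i _ => by split_ifs <;> norm_num
        by_cases hg : g < #(intruders D X)
        · rw [if_pos hg]
          have := sum_nonneg hs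
          split_ifs <;> linarith
        · rw [if_neg hg, zero_add]
          split_ifs with hX
          · obtain ⟨i, hiD, hi⟩ : ∃ i ∈ D, i ∉ definiteDefectives X (outcome X D) := by
              by_contra! hc
              exact hX (Subset.antisymm (definiteDefectives_subset X D) hc)
            refine le_trans (le_of_eq ?_) (single_le_sum hs hiD)
            rw [if_pos ⟨hi, not_lt.1 hg⟩]
          · exact sum_nonneg hs
    _ ≤ _ := by
        rw [expect_add, expect_sum]
        refine add_le_add (expect_intruders_gt_le h0 h1 D g) ?_
        rw [← nsmul_eq_mul]
        exact sum_le_card_nsmul _ _ _ fun i hi => expect_miss_le h0 h1 hi g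

lemma avgError_le (h0 : 0 ≤ p) (h1 : p ≤ 1) (N K T g : ℕ) :
    avgError DD p N K T
      ≤ N * (1 - p * (1 - p) ^ K) ^ T / (g + 1) + K * (1 - p * (1 - p) ^ (K - 1 + g)) ^ T := by
  have hx : ∀ n : ℕ, 0 ≤ 1 - p * (1 - p) ^ n := fun n => by
    have := mul_le_one₀ h1 (pow_nonneg (by linarith) n)
      (pow_le_one₀ (n := n) (show 0 ≤ 1 - p by linarith) (by linarith))
    linarith
  set B := N * (1 - p * (1 - p) ^ K) ^ T / (g + 1) + K * (1 - p * (1 - p) ^ (K - 1 + g)) ^ T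
  have hB : 0 ≤ B := by
    have h2 := pow_nonneg (hx K) T
    have h3 := pow_nonneg (hx (K - 1 + g)) T
    positivity
  have hsum : ∑ D ∈ powersetCard K (univ : Finset (Fin N)),
      bernoulliProb p {X : TestMatrix N T | DD N T X (outcome X D) ≠ D} ≤ N.choose K * B := by
    have := sum_le_card_nsmul (powersetCard K (univ : Finset (Fin N)))
      (fun D => bernoulliProb p {X : TestMatrix N T | DD N T X (outcome X D) ≠ D}) B
      (fun D hD => by
        have := bernoulliProb_error_le (T := T) h0 h1 D g
        rwa [(mem_powersetCard.1 hD).2] at this)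
    simpa using this
  rw [avgError, one_div]
  calc _ ≤ (N.choose K : ℝ)⁻¹ * (N.choose K * B) :=
        mul_le_mul_of_nonneg_left hsum (by positivity)
    _ ≤ B := by
        rw [← mul_assoc]
        -- An inequality, since for `K > N` the binomial coefficient and its inverse are both zero.
        exact mul_le_of_le_one_left hB inv_mul_le_one

end DefiniteDefectives

end GroupTesting

/-! ### Asymptotics in the regime `K ≈ N^(1-β)` -/

namespace GroupTesting

open Filter Topology

/-- Induct through `(m+1).choose (k+1) = m.choose k * (m+1)/(k+1)`, using `(m+1)/(k+1) ≤ m/k` for `0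
< k ≤ m`. -/
lemma div_pow_le_choose {n k : ℕ} (h : k ≤ n) : ((n : ℝ) / k) ^ k ≤ n.choose k := by
  induction k generalizing n with
  | zero => simp
  | succ k ih =>
    obtain ⟨m, rfl⟩ : ∃ m, n = m + 1 := ⟨n - 1, by omega⟩
    have hkm : k ≤ m := by omega
    have hstep : (((m + 1 : ℕ) : ℝ) / (k + 1 : ℕ)) ^ k ≤ ((m : ℝ) / k) ^ k := by
      rcases Nat.eq_zero_or_pos k with rfl | hk
      · simp
      · refine pow_le_pow_left₀ (by positivity) ?_ k
        have hk' : (0 : ℝ) < k := by exact_mod_cast hk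
        have : (k : ℝ) ≤ m := by exact_mod_cast hkm
        push_cast
        rw [div_le_div_iff₀ (by positivity) hk']
        nlinarith
    have hc : ((m + 1).choose (k + 1) : ℝ)
        = m.choose k * (((m + 1 : ℕ) : ℝ) / (k + 1 : ℕ)) := by
      rw [← mul_div_assoc, eq_div_iff (by positivity)]
      have := Nat.add_one_mul_choose_eq m k
      exact_mod_cast (this.symm.trans (mul_comm _ _))
    rw [hc, pow_succ]
    gcongr
    exact hstep.trans (ih hkm)

/-- A Bernoulli(`1 / K`) column avoids `n` items with probability at least `exp (-n / (K - 1))`. -/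
lemma exp_le_one_sub_inv_pow {K : ℕ} (hK : 2 ≤ K) (n : ℕ) :
    Real.exp (-(n / ((K : ℝ) - 1))) ≤ (1 - 1 / (K : ℝ)) ^ n := by
  have hK' : (2 : ℝ) ≤ K := by exact_mod_cast hK
  -- `1 - 1/K` is the inverse of `1 + 1/(K-1)`, and `1 + x ≤ exp x`.
  have h1 : Real.exp (-(1 / ((K : ℝ) - 1))) ≤ 1 - 1 / (K : ℝ) := by
    rw [Real.exp_neg]
    have h2 : (K : ℝ) / (K - 1) ≤ Real.exp (1 / ((K : ℝ) - 1)) := by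
      refine le_trans (le_of_eq ?_) (Real.add_one_le_exp _)
      have : (K : ℝ) - 1 ≠ 0 := by linarith
      field_simp
      ring
    refine (inv_anti₀ (div_pos (by linarith) (by linarith)) h2).trans (le_of_eq ?_)
    field_simp
  calc Real.exp (-(n / ((K : ℝ) - 1))) = Real.exp (-(1 / ((K : ℝ) - 1))) ^ n := by
        rw [← Real.exp_nat_mul]; congr 1; ring
    _ ≤ _ := pow_le_pow_left₀ (Real.exp_pos _).le h1 n

lemma one_sub_pow_le_exp {x : ℝ} (hx : x ≤ 1) (T : ℕ) : (1 - x) ^ T ≤ Real.exp (-(T * x)) := by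
  calc (1 - x) ^ T ≤ Real.exp (-x) ^ T :=
        pow_le_pow_left₀ (by linarith) (by linarith [Real.add_one_le_exp (-x)]) T
    _ = _ := by rw [← Real.exp_nat_mul]; congr 1; ring

/-- The error probability once the number of tests exceeds `e ρ K log N`. -/
lemma avgError_le_rpow {N K T : ℕ} {c m : ℝ} (hN : 0 < N) (hK : 2 ≤ K) (hc : 0 < c)
    (hcK : 1 + 2 * c ≤ c * K) (hT : m * K * Real.log N * Real.exp (1 + 2 * c) ≤ T) :
    avgError DD (1 / (K : ℝ)) N K T
      ≤ (N : ℝ) ^ (1 - m) / (c * K) + K * (N : ℝ) ^ (-m) := by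
  have hK' : (2 : ℝ) ≤ K := by exact_mod_cast hK
  have hN' : (0 : ℝ) < N := by exact_mod_cast hN
  have hp0 : (0 : ℝ) ≤ 1 / K := by positivity
  have hp1 : 1 / (K : ℝ) ≤ 1 := by rw [div_le_one (by linarith)]; linarith
  set g := ⌊c * K⌋₊
  have hg : (g : ℝ) ≤ c * K := Nat.floor_le (by positivity)
  have hg1 : c * K ≤ g + 1 := (Nat.lt_floor_add_one _).le
  -- Covers both exponents, `K` and `K - 1 + g`.
  have key : ∀ n : ℕ, n ≤ K + g →
      (1 - 1 / (K : ℝ) * (1 - 1 / K) ^ n) ^ T ≤ (N : ℝ) ^ (-m) := by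
    intro n hn
    have hn' : (n : ℝ) ≤ K + g := by exact_mod_cast hn
    have hle : Real.exp (-(1 + 2 * c)) ≤ (1 - 1 / (K : ℝ)) ^ n := by
      refine le_trans (Real.exp_le_exp.2 (neg_le_neg ?_)) (exp_le_one_sub_inv_pow hK n)
      -- `(1+c)K ≤ (1+2c)(K-1)` is exactly `hcK`.
      rw [div_le_iff₀ (by linarith)]
      nlinarith
    have hpn : (1 - 1 / (K : ℝ)) ^ n ≤ 1 := pow_le_one₀ (by linarith) (by linarith)
    have hpn0 : 0 ≤ (1 - 1 / (K : ℝ)) ^ n := pow_nonneg (by linarith) n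
    refine (one_sub_pow_le_exp (mul_le_one₀ hp1 hpn0 hpn) T).trans ?_
    rw [Real.rpow_def_of_pos hN', Real.exp_le_exp]
    have : m * Real.log N ≤ T * (1 / (K : ℝ) * (1 - 1 / K) ^ n) := by
      calc m * Real.log N = m * K * Real.log N * Real.exp (1 + 2 * c) *
            (1 / (K : ℝ) * Real.exp (-(1 + 2 * c))) := by
              rw [Real.exp_neg]
              field_simp
        _ ≤ T * (1 / (K : ℝ) * Real.exp (-(1 + 2 * c))) := by gcongr
        _ ≤ _ := by gcongr
    linarith
  refine (avgError_le hp0 hp1 N K T g).trans (add_le_add ?_ ?_)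
  · rw [sub_eq_add_neg (1 : ℝ) m, Real.rpow_add hN', Real.rpow_one]
    gcongr
    exact key K (by omega)
  · gcongr
    exact key _ (by omega)

lemma mul_log_le_log_choose {N K : ℕ} (hK : 0 < K) (hKN : K ≤ N) :
    K * (Real.log N - Real.log K) ≤ Real.log (N.choose K) := by
  have hK' : (0 : ℝ) < K := by exact_mod_cast hK
  have hN' : (0 : ℝ) < N := hK'.trans_le (by exact_mod_cast hKN)
  rw [← Real.log_div hN'.ne' hK'.ne', ← Real.log_pow]
  exact Real.log_le_log (by positivity) (div_pow_le_choose hKN)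

/-- Rate `R` allows about `β/(R ln 2) · K log N` tests. The two hypotheses say that this exceeds `e
· max β (1-β) · K log N`, the number that makes both error terms vanish. -/
lemma isAchievable_of_pos {β R : ℝ} (hβ0 : 0 < β) (hβ1 : β < 1) (hR : 0 < R)
    (h1 : Real.exp 1 * β < β / (R * Real.log 2))
    (h2 : Real.exp 1 * (1 - β) < β / (R * Real.log 2)) :
    IsAchievable DD (fun K : ℕ => 1 / (K : ℝ)) β R := by
  intro δ hδ
  have hl2 : 0 < Real.log 2 := Real.log_pos (by norm_num)
  have he : 0 < Real.exp 1 := Real.exp_pos 1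
  set A := β / (R * Real.log 2) with hA
  obtain ⟨m, hm, hmA⟩ : ∃ m, max β (1 - β) < m ∧ m * Real.exp 1 < A := by
    obtain ⟨m, hm, hmA⟩ := exists_between
      (show max β (1 - β) < A / Real.exp 1 from max_lt ((lt_div_iff₀ he).2 (by linarith)) ((lt_div_iff₀ he).2 (by linarith)))
    exact ⟨m, hm, (lt_div_iff₀ he).1 hmA⟩
  have hmβ : β < m := (le_max_left _ _).trans_lt hm
  have hmθ : 1 - β < m := (le_max_right _ _).trans_lt hm
  have hm0 : 0 < m := hβ0.trans hmβ
  obtain ⟨c, hc, hcA⟩ : ∃ c : ℝ, 0 < c ∧ m * Real.exp (1 + 2 * c) < A := by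
    have hcont : Tendsto (fun c : ℝ => m * Real.exp (1 + 2 * c)) (𝓝[>] 0) (𝓝 (m * Real.exp 1)) := by
      have : ContinuousAt (fun c : ℝ => m * Real.exp (1 + 2 * c)) 0 := by fun_prop
      simpa using this.tendsto.mono_left nhdsWithin_le_nhds
    obtain ⟨c, hc1, hc2⟩ := ((hcont.eventually_lt_const hmA).and self_mem_nhdsWithin).exists
    exact ⟨c, hc2, hc1⟩
  have hcast := tendsto_natCast_atTop_atTop (R := ℝ)
  have hx : Tendsto (fun N : ℕ => (N : ℝ) ^ (1 - β)) atTop atTop :=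
    (tendsto_rpow_atTop (by linarith)).comp hcast
  have hlog : Tendsto (fun N : ℕ => Real.log N) atTop atTop := Real.tendsto_log_atTop.comp hcast
  have hβpow : Tendsto (fun N : ℕ => (N : ℝ) ^ β) atTop atTop :=
    (tendsto_rpow_atTop hβ0).comp hcast
  have hdecay : Tendsto (fun N : ℕ => 2 / c * (N : ℝ) ^ (-(m - β)) + 2 * (N : ℝ) ^ (-(m - (1 - β))))
      atTop (𝓝 0) := by
    have e1 := ((tendsto_rpow_neg_atTop (sub_pos.2 hmβ)).comp hcast).const_mul (2 / c)
    have e2 := ((tendsto_rpow_neg_atTop (sub_pos.2 hmθ)).comp hcast).const_mul 2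
    simpa using e1.add e2
  have hgap : 0 < A - m * Real.exp (1 + 2 * c) := by linarith
  -- The bounds on `N^(1-β)` give `K > 2` and `1 + 2c ≤ cK`; the one on `log N` leaves room to round
  -- `T`; `N^β ≥ 2` gives `K ≤ N`.
  have hev := ((hx.eventually_ge_atTop (max 3 (1 + (1 + 2 * c) / c))).and
    ((hlog.eventually_ge_atTop ((1 + 1 / R) / (A - m * Real.exp (1 + 2 * c)))).and
    ((hβpow.eventually_ge_atTop 2).and ((hdecay.eventually_lt_const hδ).and
      (eventually_gt_atTop 1)))))
  obtain ⟨N₀, hN₀⟩ := eventually_atTop.1 hev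
  refine ⟨N₀, fun N hN K hK => ?_⟩
  obtain ⟨hx3, hlogN, hβN, hdN, hN1⟩ := hN₀ N hN
  have hN1' : (1 : ℝ) < N := by exact_mod_cast hN1
  have hN0 : (0 : ℝ) < N := by linarith
  obtain ⟨hKlo, hKhi⟩ := abs_lt.1 hK
  set x := (N : ℝ) ^ (1 - β) with hxdef
  have hx3' : 3 ≤ x := (le_max_left _ _).trans hx3
  have hK2' : (2 : ℝ) < K := by linarith
  have hK2 : 2 ≤ K := by exact_mod_cast hK2'.le
  have hK0 : (0 : ℝ) < K := by linarith
  have hcK : 1 + 2 * c ≤ c * K := by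
    have h3 : (1 + 2 * c) / c ≤ K := by linarith [(le_max_right _ _).trans hx3]
    rwa [div_le_iff₀' hc] at h3
  have hK2x : (K : ℝ) ≤ 2 * x := by linarith
  have hxK : x / 2 ≤ K := by linarith
  have hNx : (N : ℝ) = x * (N : ℝ) ^ β := by
    rw [hxdef, ← Real.rpow_add hN0]; simp
  have hKN : K ≤ N := by
    have : (K : ℝ) ≤ N := by rw [hNx]; nlinarith
    exact_mod_cast this
  have hlogpos : 0 < Real.log N := Real.log_pos hN1'
  have hlogK : Real.log K ≤ Real.log 2 + (1 - β) * Real.log N := by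
    calc Real.log K ≤ Real.log (2 * x) := Real.log_le_log hK0 hK2x
      _ = _ := by rw [Real.log_mul (by norm_num) (by positivity), hxdef, Real.log_rpow hN0]
  have hch : K * (β * Real.log N - Real.log 2) ≤ Real.log (N.choose K) :=
    le_trans (mul_le_mul_of_nonneg_left (by linarith) hK0.le) (mul_log_le_log_choose (by omega) hKN)
  set L := Real.logb 2 (N.choose K : ℝ) with hL
  have hLR : K * (A * Real.log N - 1 / R) ≤ L / R := by
    have : K * (A * Real.log N - 1 / R)
        = K * (β * Real.log N - Real.log 2) / Real.log 2 / R := by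
      rw [hA]; field_simp
    rw [this, hL, Real.logb]
    gcongr
  have hgapN : 1 + 1 / R ≤ (A - m * Real.exp (1 + 2 * c)) * Real.log N := by
    rwa [div_le_iff₀' hgap] at hlogN
  have hT' : m * K * Real.log N * Real.exp (1 + 2 * c) + 1 ≤ L / R := by
    refine le_trans ?_ hLR
    have h1R : 0 < 1 / R := by positivity
    nlinarith
  have hTpos : 0 < m * K * Real.log N * Real.exp (1 + 2 * c) := by positivity
  have hLR0 : 0 ≤ L / R := by linarith
  have hT1 : 1 ≤ ⌊L / R⌋₊ := Nat.one_le_floor_iff _ |>.2 (by linarith)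
  -- The largest `T` of rate at least `R`; the `+ 1` in `hT'` absorbs the floor.
  refine ⟨⌊L / R⌋₊, hT1, ?_, ?_⟩
  · have hT0 : (0 : ℝ) < (⌊L / R⌋₊ : ℕ) := by exact_mod_cast hT1
    rw [rate, le_div_iff₀ hT0, mul_comm, ← le_div_iff₀ hR]
    exact Nat.floor_le hLR0
  · have hTge : m * K * Real.log N * Real.exp (1 + 2 * c) ≤ (⌊L / R⌋₊ : ℕ) := by
      linarith [Nat.lt_floor_add_one (L / R)]
    refine (avgError_le_rpow (by omega) hK2 hc hcK hTge).trans (le_trans ?_ hdN.le)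
    refine add_le_add ?_ ?_
    · calc (N : ℝ) ^ (1 - m) / (c * K) ≤ (N : ℝ) ^ (1 - m) / (c * (x / 2)) := by gcongr
        _ = 2 / c * ((N : ℝ) ^ (1 - m) / x) := by field_simp
        _ = _ := by rw [hxdef, ← Real.rpow_sub hN0]; congr 2; ring
    · calc K * (N : ℝ) ^ (-m) ≤ 2 * x * (N : ℝ) ^ (-m) := by gcongr
        _ = _ := by rw [mul_assoc, hxdef, ← Real.rpow_add hN0]; congr 2; ring

end GroupTesting

theorem theorem2 (β : ℝ) (hβ0 : 0 < β) (hβ1 : β < 1) :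
    ((1 / (Real.exp 1 * Real.log 2) * min 1 (β / (1 - β)) : ℝ) : EReal) ≤
      GroupTesting.maxRate GroupTesting.DD (fun K : ℕ => 1 / (K : ℝ)) β := by
  have hl2 : 0 < Real.log 2 := Real.log_pos (by norm_num)
  have he : 0 < Real.exp 1 := Real.exp_pos 1
  have hθ : 0 < 1 - β := by linarith
  set C := 1 / (Real.exp 1 * Real.log 2) * min 1 (β / (1 - β)) with hC
  have hC0 : 0 < C := by positivity
  have hach : ∀ R, 0 < R → R < C →
      GroupTesting.IsAchievable GroupTesting.DD (fun K : ℕ => 1 / (K : ℝ)) β R := by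
    intro R hR hRC
    have h1 : R * (Real.exp 1 * Real.log 2) < min 1 (β / (1 - β)) := by
      rwa [hC, one_div_mul_eq_div, lt_div_iff₀ (by positivity)] at hRC
    refine GroupTesting.isAchievable_of_pos hβ0 hβ1 hR ?_ ?_
    · rw [lt_div_iff₀ (by positivity)]
      have := h1.trans_le (min_le_left _ _)
      nlinarith
    · have := h1.trans_le (min_le_right _ _)
      rw [lt_div_iff₀ hθ] at this
      rw [lt_div_iff₀ (by positivity)]
      linarith
  refine le_of_forall_lt fun b hb => ?_
  obtain ⟨R, hbR, hRC⟩ := EReal.lt_iff_exists_real_btwn.1 hb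
  rw [EReal.coe_lt_coe_iff] at hRC
  -- `R` may be nonpositive; the maximum with `C / 2` is positive and still below `C`.
  refine hbR.trans_le (le_trans (EReal.coe_le_coe_iff.2 (le_max_left R (C / 2))) ?_)
  exact le_sSup ⟨_, hach _ (lt_max_of_lt_right (by linarith)) (max_lt hRC (by linarith)), rfl⟩
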